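/- For integers $n,m\ge 0$ let $a_{n,m}$ be the number of unit step paths of length $n$ on $\mathbb{Z}_{\ge 0}$ starting at $0$ and ending at $m$. Fix an integer $\ell\ge 2$, and define $b_{n,m}=b_{n,m}(\ell)$ for $n,m\ge 0$ by $b_{0,0}=1$, $b_{0,m}=0$ for $m\ge 1$, and, for $n\ge 1$, \[ b_{n,m}=\begin{cases} a_{n,m} & \text{if } m\equiv -1 \bmod \ell,\\ b_{n-1,m-1} & \text{if } m\equiv -2\bmod \ell,\\ b_{n-1,m-1}+b_{n-1,m+1} & \text{otherwise,}\end{cases} \] where $b_{n-1,-1}=0$. Let $b_n=\sum_{m\ge 0}b_{n,m}=\sum_{m=0}^{n}b_{n,m}$. For $n\ge 1$ put $a_n^a=\sqrt{2/\pi}\cdot n^{-1/2}\cdot 2^n$ and \[ b_n^a=\begin{cases}\dfrac{\ell+1}{2\ell}\cdot a_n^a & \text{if } \ell \text{ is odd},\\[2ex] \dfrac{\ell+1+(-1)^{n+1}}{2\ell}\cdot a_n^a & \text{if } \ell\text{ is even}.\end{cases} \] Then, as $n\to\infty$, $b_n\sim b_n^a$, and \[ \frac{|b_n-b_n^a|}{n^{-1/2}\cdot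 2^n}\in O\!\left(\tfrac1n\right), \] where the implied constant may depend on $\ell$. -/

import Mathlib

/-- The number of unit step paths of length `n` on the nonnegative integers that start at `0`
and end at `m`: sequences `p 0, …, p n` of natural numbers with `p 0 = 0`, `p n = m` and
`p (i + 1) = p i ± 1` for every `i < n`. -/
noncomputable def halfLineWalks (n m : ℕ) : ℕ :=
  Nat.card {p : Fin (n + 1) → ℕ //
    p 0 = 0 ∧ p (Fin.last n) = m ∧
      ∀ i : Fin n, p i.succ = p i.castSucc + 1 ∨ p i.castSucc = p i.succ + 1}

/-- The modular half-line walk numbers `b_{n,m}` for the modulus `ℓ`. The walk starts at `0`, so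
`b_{0,m}` is `1` for `m = 0` and `0` otherwise. For `n ≥ 1` the value depends on `m` modulo `ℓ`:
it is the number of half-line walks if `m ≡ -1`, it is `b_{n-1,m-1}` if `m ≡ -2`, and it is
`b_{n-1,m-1} + b_{n-1,m+1}` for all other residues. A term with second index `-1` is `0`. -/
noncomputable def modWalks (ℓ : ℕ) : ℕ → ℕ → ℕ
  | 0, m => if m = 0 then 1 else 0
  | n + 1, m =>
      let left : ℕ := match m with
        | 0 => 0
        | k + 1 => modWalks ℓ n k
      if (m : ℤ) ≡ -1 [ZMOD ℓ] then halfLineWalks (n + 1) m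
      else if (m : ℤ) ≡ -2 [ZMOD ℓ] then left
      else left + modWalks ℓ n (m + 1)

/-- `b_n`, the sum of `b_{n,m}` over all `m ≥ 0`. A walk of length `n` ends at some `m ≤ n`, so
only the terms with `m ≤ n` can be nonzero. -/
noncomputable def modWalkCount (ℓ n : ℕ) : ℕ :=
  ∑ m ∈ Finset.range (n + 1), modWalks ℓ n m

/-- `√(2/π) · n^(-1/2) · 2^n`. -/
noncomputable def halfLineAsymp (n : ℕ) : ℝ :=
  Real.sqrt (2 / Real.pi) * (n : ℝ) ^ (-(1 / 2) : ℝ) * 2 ^ n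

/-- The asymptotic formula for `b_n`. -/
noncomputable def modWalkAsymp (ℓ n : ℕ) : ℝ :=
  if Odd ℓ then ((ℓ : ℝ) + 1) / (2 * ℓ) * halfLineAsymp n
  else ((ℓ : ℝ) + 1 + (-1) ^ (n + 1)) / (2 * ℓ) * halfLineAsymp n

/-! By the reflection principle, `a_{n,m}` is `signedWalks n m`, a solution of the walk recurrence
on all of ℤ that is antisymmetric about `-1`. Points `m ≡ -1` are walls. Between two walls `b` obeys
the plain recurrence, with boundary value `0` on the upper wall and `a` on the lower one, so
repeated reflection writes it as an alternating sum of signed walks (`modWalks_eq_stripWalks`).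
Summed over all strips this telescopes to `b_n = ∑ w(x) · signedWalks n x`, where `w` is the
`2ℓ`-periodic indicator of the residues `-1, …, ℓ - 1` (`modWalkCount_eq_sum_residueWeight`).

Put `x = n - 2u`. Then `signedWalks n x` is the coefficient of `X^u` in `p = (1 - X)(1 + X)^n`, and
the weight has period `ℓ` in `u`. Its mean is the density `δ` of the asymptotic formula. Since the
coefficients of `p` up to `n / 2` add up to the middle binomial coefficient, the mean contributes `δ
· C(n, n/2)`. The mean-zero rest is summed by parts twice and is bounded by the ℓ¹ norm of the
coefficients of `(1 - X)^3 (1 + X)^n`. That norm is submultiplicative; splitting `n` into thirds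
gives three factors `(1 - X)(1 + X)^a`, each `O(2^a / √a)`, so the error is `O(2^n n^{-3/2})`.
Wallis' product gives `C(n, n/2)` to the same accuracy. -/

/-! ### Half-line walks -/

/-- The set of half-line walks counted by `halfLineWalks n m`. -/
abbrev HalfLineWalk (n m : ℕ) : Type :=
  {p : Fin (n + 1) → ℕ //
    p 0 = 0 ∧ p (Fin.last n) = m ∧
      ∀ i : Fin n, p i.succ = p i.castSucc + 1 ∨ p i.castSucc = p i.succ + 1}

/-- The path determines its endpoint, so no transport along an equality of endpoints is needed. -/
theorem HalfLineWalk.sigma_ext {n : ℕ} {a b : Σ k : ℕ, HalfLineWalk n k}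
    (h : a.2.1 = b.2.1) : a = b := by
  obtain ⟨k, p, h0, hk, hp⟩ := a
  obtain ⟨l, q, h0', hl, hq⟩ := b
  simp only at h
  subst h hk hl
  rfl

/-- Removing the last step of a walk. -/
def halfLineWalkSuccEquiv (n m : ℕ) :
    HalfLineWalk (n + 1) m ≃ {q : Σ k : ℕ, HalfLineWalk n k // m = q.1 + 1 ∨ q.1 = m + 1} where
  toFun p := ⟨⟨p.1 (Fin.last n).castSucc, ⟨Fin.init p.1, by
      refine ⟨?_, rfl, fun i => ?_⟩
      · simpa [Fin.init] using p.2.1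
      · simpa [Fin.init] using p.2.2.2 i.castSucc⟩⟩, by
      have h := p.2.2.2 (Fin.last n)
      have h2 := p.2.2.1
      rw [Fin.succ_last] at h
      simpa [h2] using h⟩
  invFun q := ⟨Fin.snoc q.1.2.1 m, by
      obtain ⟨⟨k, p, h0, hk, hp⟩, hq⟩ := q
      refine ⟨?_, by simp, fun i => ?_⟩
      · have : (0 : Fin (n + 2)) = Fin.castSucc 0 := rfl
        rw [this, Fin.snoc_castSucc]
        exact h0
      · refine Fin.lastCases ?_ (fun i => ?_) i
        · rw [Fin.succ_last, Fin.snoc_last, Fin.snoc_castSucc]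
          simpa [hk] using hq
        · rw [Fin.succ_castSucc, Fin.snoc_castSucc, Fin.snoc_castSucc]
          exact hp i⟩
  left_inv p := by
    apply Subtype.ext
    have h2 := p.2.2.1
    simp only
    conv_rhs => rw [← Fin.snoc_init_self p.1, h2]
  right_inv q := by
    apply Subtype.ext
    apply HalfLineWalk.sigma_ext
    simp only [Fin.init_snoc]

/-- The walks of length `n + 1` ending at `m` whose last but one point is prescribed. -/
def halfLineWalkFiberEquiv (n m : ℕ) :
    HalfLineWalk (n + 1) m ≃ HalfLineWalk n (m + 1) ⊕ {_q : HalfLineWalk n (m - 1) // 1 ≤ m} :=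
  (halfLineWalkSuccEquiv n m).trans
    { toFun := fun q =>
        if h : q.1.1 = m + 1 then Sum.inl (h ▸ q.1.2)
        -- For `m = 0` the truncated `m - 1` is a junk value; the condition `1 ≤ m` makes this
        -- summand empty.
        else Sum.inr ⟨(show q.1.1 = m - 1 by have := q.2; omega) ▸ q.1.2,
          by have := q.2; omega⟩
      invFun := Sum.elim (fun p => ⟨⟨m + 1, p⟩, Or.inr rfl⟩)
        (fun p => ⟨⟨m - 1, p.1⟩, Or.inl (by have := p.2; simp only; omega)⟩)
      left_inv := by
        rintro ⟨⟨k, p⟩, hq⟩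
        by_cases h : k = m + 1
        · subst h
          simp
        · have hk : k = m - 1 := by simp only at hq; omega
          subst hk
          simp [h]
      right_inv := by
        rintro (p | ⟨p, hp⟩)
        · simp
        · have : m - 1 ≠ m + 1 := by omega
          simp [this] }

theorem halfLineWalk_zero_iff (m : ℕ) (p : Fin 1 → ℕ) :
    (p 0 = 0 ∧ p (Fin.last 0) = m ∧
      ∀ i : Fin 0, p i.succ = p i.castSucc + 1 ∨ p i.castSucc = p i.succ + 1) ↔
      p = 0 ∧ m = 0 := by
  constructor
  · rintro ⟨h0, h1, -⟩
    refine ⟨?_, ?_⟩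
    · ext i
      rw [Subsingleton.elim i 0, h0]
      rfl
    · exact h1.symm.trans h0
  · rintro ⟨rfl, rfl⟩
    exact ⟨rfl, rfl, fun i => i.elim0⟩

instance finite_halfLineWalk (n m : ℕ) : Finite (HalfLineWalk n m) := by
  induction n generalizing m with
  | zero =>
    refine Finite.of_injective (fun _ => ()) ?_
    rintro ⟨p, hp⟩ ⟨q, hq⟩ -
    apply Subtype.ext
    exact ((halfLineWalk_zero_iff m p).1 hp).1.trans ((halfLineWalk_zero_iff m q).1 hq).1.symm
  | succ n ih =>
    have := ih (m + 1)
    have := ih (m - 1)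
    exact Finite.of_equiv _ (halfLineWalkFiberEquiv n m).symm

theorem halfLineWalks_zero (m : ℕ) : halfLineWalks 0 m = if m = 0 then 1 else 0 := by
  have h := Nat.card_congr (Equiv.subtypeEquivRight (halfLineWalk_zero_iff m))
  unfold halfLineWalks
  refine h.trans ?_
  split_ifs with hm
  · simp [hm]
  · simp [hm]

theorem halfLineWalks_succ (n m : ℕ) :
    halfLineWalks (n + 1) m =
      (if 1 ≤ m then halfLineWalks n (m - 1) else 0) + halfLineWalks n (m + 1) := by
  have h := Nat.card_congr (halfLineWalkFiberEquiv n m)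
  rw [Nat.card_sum] at h
  refine h.trans ?_
  rw [add_comm]
  congr 1
  split_ifs with hm
  · exact Nat.card_congr (Equiv.subtypeUnivEquiv fun _ => hm)
  · simp [hm]

/-- Signed walks on `ℤ`: walks from `0` minus walks from `-2`. By reflection, these count
half-line walks. -/
def signedWalks : ℕ → ℤ → ℤ
  | 0, x => if x = 0 then 1 else if x = -2 then -1 else 0
  | n + 1, x => signedWalks n (x - 1) + signedWalks n (x + 1)

theorem signedWalks_reflect (n : ℕ) (x : ℤ) : signedWalks n (-2 - x) = -signedWalks n x := by
  induction n generalizing x with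
  | zero =>
    simp only [signedWalks]
    split_ifs <;> omega
  | succ n ih =>
    have h1 := ih (x - 1)
    have h2 := ih (x + 1)
    simp only [signedWalks]
    rw [show -2 - x - 1 = -2 - (x + 1) by ring, show -2 - x + 1 = -2 - (x - 1) by ring, h1, h2]
    ring

theorem signedWalks_neg_one (n : ℕ) : signedWalks n (-1) = 0 := by
  have := signedWalks_reflect n (-1)
  norm_num at this
  omega

theorem signedWalks_eq_zero_of_lt {n : ℕ} {x : ℤ} (h : n < x) : signedWalks n x = 0 := by
  induction n generalizing x with
  | zero =>
    simp only [signedWalks]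
    split_ifs <;> simp at h <;> omega
  | succ n ih =>
    push_cast at h
    simp only [signedWalks]
    rw [ih (by omega), ih (by omega), add_zero]

theorem signedWalks_eq_zero_of_odd {n : ℕ} {x : ℤ} (h : Odd (n - x)) : signedWalks n x = 0 := by
  induction n generalizing x with
  | zero =>
    simp only [signedWalks]
    obtain ⟨k, hk⟩ := h
    split_ifs <;> simp at hk <;> omega
  | succ n ih =>
    obtain ⟨k, hk⟩ := h
    push_cast at hk
    simp only [signedWalks]
    rw [ih ⟨k, by omega⟩, ih ⟨k - 1, by omega⟩, add_zero]

/-- Antisymmetry forces the value `0` at `-1`, which is the boundary condition of the half-line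
recurrence. -/
theorem halfLineWalks_eq_signedWalks (n m : ℕ) : (halfLineWalks n m : ℤ) = signedWalks n m := by
  induction n generalizing m with
  | zero =>
    rw [halfLineWalks_zero]
    simp only [signedWalks]
    split_ifs <;> first | rfl | omega
  | succ n ih =>
    rw [halfLineWalks_succ]
    simp only [signedWalks]
    push_cast [ih]
    congr 1
    split_ifs with h
    · congr 1
      omega
    · obtain rfl : m = 0 := by omega
      simp [signedWalks_neg_one]

/-! ### The modular walk numbers by reflection at the walls -/

/-- The solution of the walk recurrence in the `k`-th strip with value `0` on its upper wall and
the half-line walk numbers on its lower wall. -/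
def stripWalks (ℓ T n : ℕ) (k j : ℤ) : ℤ :=
  ∑ i ∈ Finset.range T,
    (signedWalks n ((k + 2 * i) * ℓ + j) - signedWalks n ((k + 2 * i + 2) * ℓ - 2 - j))

theorem stripWalks_succ (ℓ T n : ℕ) (k j : ℤ) :
    stripWalks ℓ T (n + 1) k j = stripWalks ℓ T n k (j - 1) + stripWalks ℓ T n k (j + 1) := by
  simp only [stripWalks, ← Finset.sum_add_distrib]
  refine Finset.sum_congr rfl fun i _ => ?_
  simp only [signedWalks]
  ring_nf

/-- The two arguments in each summand are mirror images in the upper wall, so they coincide there.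
-/
theorem stripWalks_upper (ℓ T n : ℕ) (k : ℤ) : stripWalks ℓ T n k (ℓ - 1) = 0 := by
  refine Finset.sum_eq_zero fun i _ => ?_
  ring_nf

/-- On the lower wall the sum over `i` telescopes. The bound `n < T` puts the last term out of reach
of a walk of length `n`. -/
theorem stripWalks_lower {ℓ T n : ℕ} (hℓ : 1 ≤ ℓ) (hT : n < T) (k : ℕ) :
    stripWalks ℓ T n k (-1) = signedWalks n (k * ℓ - 1) := by
  have h := Finset.sum_range_sub' (fun i : ℕ => signedWalks n ((k + 2 * i) * ℓ + -1)) T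
  have h0 : signedWalks n (((k : ℤ) + 2 * (T : ℕ)) * ℓ + -1) = 0 := by
    apply signedWalks_eq_zero_of_lt
    have h1 : (T : ℤ) ≤ T * ℓ := by
      have : (1 : ℤ) ≤ ℓ := by exact_mod_cast hℓ
      nlinarith
    have h2 : (0 : ℤ) ≤ (k : ℤ) * ℓ := by positivity
    have h3 : ((n : ℕ) : ℤ) < T := by exact_mod_cast hT
    nlinarith
  rw [h0] at h
  simp only [Nat.cast_zero, mul_zero, add_zero, sub_zero] at h
  rw [show (k * ℓ - 1 : ℤ) = k * ℓ + -1 by ring, ← h]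
  refine Finset.sum_congr rfl fun i _ => ?_
  push_cast
  ring_nf

theorem modEq_neg_one_iff {ℓ k j : ℕ} (hj : j < ℓ) :
    (((k * ℓ + j : ℕ) : ℤ) ≡ -1 [ZMOD ℓ]) ↔ j + 1 = ℓ := by
  rw [Int.modEq_iff_dvd]
  constructor
  · rintro ⟨c, hc⟩
    push_cast at hc
    have h1 : ((j : ℤ) + 1) = ℓ * (-c - k) := by linarith
    have h2 : (ℓ : ℤ) ∣ ((j + 1 : ℕ) : ℤ) := ⟨-c - k, by push_cast; exact h1⟩
    have h3 := Nat.le_of_dvd (by omega) (Int.natCast_dvd_natCast.1 h2)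
    omega
  · rintro rfl
    exact ⟨-k - 1, by push_cast; ring⟩

theorem modEq_neg_two_iff {ℓ k j : ℕ} (hj : j + 1 < ℓ) :
    (((k * ℓ + j : ℕ) : ℤ) ≡ -2 [ZMOD ℓ]) ↔ j + 2 = ℓ := by
  rw [Int.modEq_iff_dvd]
  constructor
  · rintro ⟨c, hc⟩
    push_cast at hc
    have h1 : ((j : ℤ) + 2) = ℓ * (-c - k) := by linarith
    have h2 : (ℓ : ℤ) ∣ ((j + 2 : ℕ) : ℤ) := ⟨-c - k, by push_cast; exact h1⟩
    have h3 := Nat.le_of_dvd (by omega) (Int.natCast_dvd_natCast.1 h2)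
    omega
  · rintro rfl
    exact ⟨-k - 1, by push_cast; ring⟩

theorem modWalks_zero (ℓ m : ℕ) : modWalks ℓ 0 m = if m = 0 then 1 else 0 := by
  rw [modWalks]

theorem modWalks_succ (ℓ n m : ℕ) :
    modWalks ℓ (n + 1) m =
      if (m : ℤ) ≡ -1 [ZMOD ℓ] then halfLineWalks (n + 1) m
      else if (m : ℤ) ≡ -2 [ZMOD ℓ] then (if m = 0 then 0 else modWalks ℓ n (m - 1))
      else (if m = 0 then 0 else modWalks ℓ n (m - 1)) + modWalks ℓ n (m + 1) := by
  cases m <;> rw [modWalks] <;> simp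

/-- Both sides have the same initial values, recurrence and boundary values. The extra term restores
the wall value, which `stripWalks` replaces by `0` because the point below the wall receives nothing
from it. -/
theorem modWalks_eq_stripWalks {ℓ T n : ℕ} (hℓ : 2 ≤ ℓ) (hT : n < T) (k j : ℕ) (hj : j < ℓ) :
    (modWalks ℓ n (k * ℓ + j) : ℤ) = stripWalks ℓ T n k j +
      if j + 1 = ℓ then signedWalks n ((k * ℓ + j : ℕ) : ℤ) else 0 := by
  induction n generalizing k j with
  | zero =>
    have hpos : ∀ x : ℤ, 0 < x → signedWalks 0 x = 0 := fun x hx =>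
      signedWalks_eq_zero_of_lt (by simpa using hx)
    have hwall : (if j + 1 = ℓ then signedWalks 0 ((k * ℓ + j : ℕ) : ℤ) else 0) = 0 := by
      split_ifs with h
      · exact hpos _ (by exact_mod_cast (show 0 < k * ℓ + j by omega))
      · rfl
    have hsnd : ∀ i : ℕ, signedWalks 0 (((k : ℤ) + 2 * i + 2) * ℓ - 2 - j) = 0 := by
      intro i
      apply hpos
      have h1 : (0 : ℤ) ≤ (k + 2 * i) * ℓ := by positivity
      have h2 : (j : ℤ) < ℓ := by exact_mod_cast hj
      have h3 : (2 : ℤ) ≤ ℓ := by exact_mod_cast hℓ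
      nlinarith
    rw [modWalks_zero, hwall, add_zero, stripWalks]
    simp only [hsnd, sub_zero]
    rw [Finset.sum_eq_single 0]
    · by_cases h : k * ℓ + j = 0
      · have hc : ((k : ℤ) + 2 * (0 : ℕ)) * ℓ + j = 0 := by
          have : ((k * ℓ + j : ℕ) : ℤ) = 0 := by rw [h]; rfl
          push_cast at this ⊢
          linarith
        rw [if_pos h, hc]
        rfl
      · rw [if_neg h, hpos]
        · rfl
        · have : (0 : ℤ) < ((k * ℓ + j : ℕ) : ℤ) := by exact_mod_cast Nat.pos_of_ne_zero h
          push_cast at this ⊢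
          linarith
    · intro i _ hi
      apply hpos
      have : (0 : ℤ) < ((k + 2 * i) * ℓ : ℕ) := by
        have : 0 < k + 2 * i := by omega
        exact_mod_cast Nat.mul_pos this (by omega)
      push_cast at this
      have h2 : (0 : ℤ) ≤ j := by positivity
      linarith
    · intro h
      exact absurd (Finset.mem_range.2 hT) h
  | succ n ih =>
    have ih := fun k j hj => ih (by omega) k j hj
    rw [modWalks_succ]
    by_cases h1 : j + 1 = ℓ
    · rw [if_pos ((modEq_neg_one_iff hj).2 h1), if_pos h1, halfLineWalks_eq_signedWalks,
        show (j : ℤ) = ℓ - 1 by omega, stripWalks_upper, zero_add]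
    · have hj1 : j + 1 < ℓ := by omega
      rw [if_neg (mt (modEq_neg_one_iff hj).1 h1), if_neg h1, add_zero, stripWalks_succ]
      -- For `j = 0` the left neighbour is the wall on top of strip `k - 1`, or the point `-1` if `k
      -- = 0`.
      have hleft : (((if k * ℓ + j = 0 then 0 else modWalks ℓ n (k * ℓ + j - 1)) : ℕ) : ℤ) =
          stripWalks ℓ T n k (j - 1) := by
        rcases Nat.eq_zero_or_pos j with rfl | hj0
        · rw [show ((0 : ℕ) : ℤ) - 1 = -1 by norm_num,
            stripWalks_lower (by omega) (show n < T by omega)]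
          rcases Nat.eq_zero_or_pos k with rfl | hk
          · simp [signedWalks_neg_one]
          · obtain ⟨k, rfl⟩ : ∃ k', k = k' + 1 := ⟨k - 1, by omega⟩
            have hx : (k + 1) * ℓ + 0 - 1 = k * ℓ + (ℓ - 1) := by
              rw [Nat.add_mul]
              omega
            have hne : (k + 1) * ℓ + 0 ≠ 0 := by
              rw [Nat.add_mul]
              omega
            rw [if_neg hne, hx, ih k (ℓ - 1) (by omega), if_pos (by omega),
              show ((ℓ - 1 : ℕ) : ℤ) = ℓ - 1 by omega, stripWalks_upper, zero_add]
            congr 1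
            push_cast [show 1 ≤ ℓ by omega]
            ring
        · rw [if_neg (by omega), Nat.add_sub_assoc hj0, ih k (j - 1) (by omega),
            if_neg (by omega), add_zero, Nat.cast_sub hj0, Nat.cast_one]
      by_cases h2 : j + 2 = ℓ
      · rw [if_pos ((modEq_neg_two_iff hj1).2 h2), hleft, show (j : ℤ) + 1 = ℓ - 1 by omega,
          stripWalks_upper, add_zero]
      · rw [if_neg (mt (modEq_neg_two_iff hj1).1 h2), Nat.cast_add, hleft, add_assoc,
          ih k (j + 1) hj1, if_neg (by omega), add_zero, Nat.cast_add, Nat.cast_one]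

theorem modWalks_eq_zero_of_lt {ℓ n m : ℕ} (hℓ : 2 ≤ ℓ) (h : n < m) : modWalks ℓ n m = 0 := by
  have hj : m % ℓ < ℓ := Nat.mod_lt _ (by omega)
  have key := modWalks_eq_stripWalks hℓ (Nat.lt_succ_self n) (m / ℓ) (m % ℓ) hj
  have hm : m / ℓ * ℓ + m % ℓ = m := by rw [mul_comm]; exact Nat.div_add_mod m ℓ
  have hmz : ((m / ℓ : ℕ) : ℤ) * ℓ + ((m % ℓ : ℕ) : ℤ) = m := by exact_mod_cast hm
  have hjz : ((m % ℓ : ℕ) : ℤ) < ℓ := by exact_mod_cast hj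
  have hnz : (n : ℤ) < m := by exact_mod_cast h
  rw [hm, signedWalks_eq_zero_of_lt (n := n) (x := m) (by exact_mod_cast h), ite_self, add_zero,
    stripWalks, Finset.sum_eq_zero] at key
  · exact_mod_cast key
  · intro i _
    have hi : (0 : ℤ) ≤ (i : ℤ) * ℓ := by positivity
    rw [signedWalks_eq_zero_of_lt, signedWalks_eq_zero_of_lt, sub_zero]
    · nlinarith
    · nlinarith

theorem sum_range_mul_eq (f : ℕ → ℤ) (K ℓ : ℕ) :
    ∑ x ∈ Finset.range (K * ℓ), f x =
      ∑ k ∈ Finset.range K, ∑ j ∈ Finset.range ℓ, f (k * ℓ + j) := by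
  induction K with
  | zero => simp
  | succ K ih => rw [Nat.add_mul, one_mul, Finset.sum_range_add, ih, Finset.sum_range_succ]

/-- The sum of the strip numbers telescopes. -/
theorem sum_stripWalks {ℓ T n : ℕ} (hℓ : 2 ≤ ℓ) (hT : n < T) :
    ∑ k ∈ Finset.range (2 * T), ∑ j ∈ Finset.range ℓ, stripWalks ℓ T n k j =
      ∑ i ∈ Finset.range T, ∑ j ∈ Finset.range (ℓ - 1), signedWalks n (2 * i * ℓ + j) := by
  obtain ⟨d, rfl⟩ : ∃ d, ℓ = d + 1 := ⟨ℓ - 1, by omega⟩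
  -- Reversing `j` in the reflected terms turns them into the direct terms of strip `k + 1`, so the
  -- sum over `k` telescopes.
  have hstrip : ∀ k ∈ Finset.range (2 * T),
      ∑ j ∈ Finset.range (d + 1), stripWalks (d + 1) T n k j =
        ∑ i ∈ Finset.range T, ∑ j ∈ Finset.range d,
          (signedWalks n ((k + 2 * i) * (d + 1 : ℕ) + j) -
            signedWalks n ((k + 1 + 2 * i) * (d + 1 : ℕ) + j)) := by
    intro k _
    have htop : stripWalks (d + 1) T n k (d : ℕ) = 0 := by
      have := stripWalks_upper (d + 1) T n k
      push_cast at this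
      rwa [add_sub_cancel_right] at this
    rw [Finset.sum_range_succ, htop, add_zero]
    simp only [stripWalks]
    rw [Finset.sum_comm]
    refine Finset.sum_congr rfl fun i _ => ?_
    rw [Finset.sum_sub_distrib, Finset.sum_sub_distrib]
    congr 1
    rw [← Finset.sum_range_reflect]
    refine Finset.sum_congr rfl fun j hj => ?_
    have hj := Finset.mem_range.1 hj
    congr 1
    rw [show ((d - 1 - j : ℕ) : ℤ) = d - 1 - j by omega]
    push_cast
    ring
  rw [Finset.sum_congr rfl hstrip, Finset.sum_comm]
  refine Finset.sum_congr rfl fun i _ => ?_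
  rw [Finset.sum_comm]
  refine Finset.sum_congr rfl fun j _ => ?_
  have h := Finset.sum_range_sub' (fun k : ℕ => signedWalks n ((k + 2 * i) * (d + 1 : ℕ) + j))
    (2 * T)
  have h0 : signedWalks n ((((2 * T : ℕ) : ℤ) + 2 * i) * (d + 1 : ℕ) + j) = 0 := by
    apply signedWalks_eq_zero_of_lt
    have : n < (2 * T + 2 * i) * (d + 1) + j := by nlinarith
    exact_mod_cast this
  rw [h0, sub_zero] at h
  simp only [Nat.cast_zero, zero_add] at h
  rw [← h]
  refine Finset.sum_congr rfl fun k _ => ?_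
  push_cast
  ring_nf

theorem modWalkCount_eq_sum_blocks {ℓ T n : ℕ} (hℓ : 2 ≤ ℓ) (hT : n < T) :
    (modWalkCount ℓ n : ℤ) =
      ∑ i ∈ Finset.range T, ∑ j ∈ Finset.range (ℓ - 1), signedWalks n (2 * i * ℓ + j) +
        ∑ k ∈ Finset.range (2 * T), signedWalks n (k * ℓ + (ℓ - 1)) := by
  have hle : n + 1 ≤ 2 * T * ℓ := by nlinarith
  have h1 : modWalkCount ℓ n = ∑ m ∈ Finset.range (2 * T * ℓ), modWalks ℓ n m := by
    refine Finset.sum_subset (Finset.range_mono hle) fun m _ hm => ?_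
    exact modWalks_eq_zero_of_lt hℓ (by simpa using hm)
  rw [h1, Nat.cast_sum, sum_range_mul_eq, ← sum_stripWalks hℓ hT, ← Finset.sum_add_distrib]
  refine Finset.sum_congr rfl fun k _ => ?_
  rw [Finset.sum_congr rfl fun j hj =>
    modWalks_eq_stripWalks hℓ hT k j (Finset.mem_range.1 hj), Finset.sum_add_distrib]
  congr 1
  rw [Finset.sum_eq_single (ℓ - 1)]
  · rw [if_pos (by omega)]
    congr 1
    push_cast [show 1 ≤ ℓ by omega]
    ring
  · intro j _ hj
    rw [if_neg (by omega)]
  · intro h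
    exact absurd (Finset.mem_range.2 (by omega)) h

/-- The `2ℓ`-periodic indicator of the residues `-1, 0, …, ℓ - 1`. -/
def residueWeight (ℓ : ℕ) (x : ℤ) : ℤ := if (x + 1) % (2 * ℓ) ≤ ℓ then 1 else 0

theorem residueWeight_add_period (ℓ : ℕ) (x c : ℤ) :
    residueWeight ℓ (2 * ℓ * c + x) = residueWeight ℓ x := by
  rw [residueWeight, residueWeight, add_assoc, Int.mul_add_emod_self_left]

theorem residueWeight_of_lt {ℓ : ℕ} {x : ℤ} (h0 : 0 ≤ x) (h : x + 1 < 2 * ℓ) :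
    residueWeight ℓ x = if x + 1 ≤ ℓ then 1 else 0 := by
  rw [residueWeight, Int.emod_eq_of_lt (by omega) h]

theorem residueWeight_last (ℓ : ℕ) : residueWeight ℓ (2 * ℓ - 1) = 1 := by
  simp [residueWeight]

theorem modWalkCount_eq_sum_residueWeight {ℓ : ℕ} (n : ℕ) (hℓ : 2 ≤ ℓ) :
    (modWalkCount ℓ n : ℤ) =
      ∑ x ∈ Finset.range (n + 1), residueWeight ℓ x * signedWalks n x := by
  have hle : n + 1 ≤ (n + 1) * (2 * ℓ) := by nlinarith
  have h1 : ∑ x ∈ Finset.range (n + 1), residueWeight ℓ x * signedWalks n x =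
      ∑ x ∈ Finset.range ((n + 1) * (2 * ℓ)), residueWeight ℓ x * signedWalks n x := by
    refine Finset.sum_subset (Finset.range_mono hle) fun m _ hm => ?_
    rw [signedWalks_eq_zero_of_lt, mul_zero]
    simp at hm
    exact_mod_cast hm
  -- A block of length `2ℓ` contains two walls, at offsets `ℓ - 1` and `2ℓ - 1`.
  have hodd : ∀ f : ℕ → ℤ, ∀ T : ℕ, ∑ k ∈ Finset.range (2 * T), f k =
      ∑ i ∈ Finset.range T, (f (2 * i) + f (2 * i + 1)) := by
    intro f T
    rw [mul_comm, sum_range_mul_eq]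
    refine Finset.sum_congr rfl fun i _ => ?_
    simp [Finset.sum_range_succ, mul_comm]
  rw [modWalkCount_eq_sum_blocks hℓ (Nat.lt_succ_self n), h1, hodd, sum_range_mul_eq,
    ← Finset.sum_add_distrib]
  refine Finset.sum_congr rfl fun i _ => ?_
  obtain ⟨d, rfl⟩ : ∃ d, ℓ = d + 1 := ⟨ℓ - 1, by omega⟩
  have hw : ∀ y : ℕ, residueWeight (d + 1) ((i * (2 * (d + 1)) + y : ℕ) : ℤ) =
      residueWeight (d + 1) y := by
    intro y
    rw [← residueWeight_add_period (d + 1) y i]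
    congr 1
    push_cast
    ring
  simp only [hw]
  rw [show 2 * (d + 1) = (d + 1) + d + 1 by ring, Finset.sum_range_succ,
    Finset.sum_range_add, Finset.sum_range_succ]
  have hlow : ∀ j : ℕ, j ≤ d → residueWeight (d + 1) j = 1 := by
    intro j hj
    rw [residueWeight_of_lt (by omega) (by push_cast; omega), if_pos (by push_cast; omega)]
  have hmid : ∀ j : ℕ, j < d → residueWeight (d + 1) ((d + 1 + j : ℕ) : ℤ) = 0 := by
    intro j hj
    rw [residueWeight_of_lt (by omega) (by push_cast; omega), if_neg (by push_cast; omega)]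
  have hlast : residueWeight (d + 1) ((d + 1 + d : ℕ) : ℤ) = 1 := by
    rw [← residueWeight_last (d + 1)]
    congr 1
    push_cast
    ring
  have hsum_low : ∀ f : ℕ → ℤ, ∑ j ∈ Finset.range d, residueWeight (d + 1) j * f j =
      ∑ j ∈ Finset.range d, f j := fun f => Finset.sum_congr rfl fun j hj => by
    rw [hlow j (Finset.mem_range.1 hj).le, one_mul]
  have hsum_mid : ∀ f : ℕ → ℤ,
      ∑ j ∈ Finset.range d, residueWeight (d + 1) ((d + 1 + j : ℕ) : ℤ) * f j = 0 :=
    fun f => Finset.sum_eq_zero fun j hj => by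
      rw [hmid j (Finset.mem_range.1 hj), zero_mul]
  rw [hlast, hlow d le_rfl, hsum_low, hsum_mid, add_zero, one_mul, one_mul, add_assoc,
    Nat.add_sub_cancel]
  push_cast
  congr 1
  · refine Finset.sum_congr rfl fun j _ => ?_
    congr 1
    ring
  · congr 2 <;> ring

/-! ### The sum of the absolute values of the coefficients of a polynomial -/

/-- The sum of the absolute values of the coefficients. -/
noncomputable def coeffNorm (p : Polynomial ℝ) : ℝ := ∑ i ∈ p.support, |p.coeff i|

theorem coeffNorm_nonneg (p : Polynomial ℝ) : 0 ≤ coeffNorm p :=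
  Finset.sum_nonneg fun _ _ => abs_nonneg _

theorem sum_abs_coeff_le_coeffNorm (p : Polynomial ℝ) (s : Finset ℕ) :
    ∑ i ∈ s, |p.coeff i| ≤ coeffNorm p := by
  have h : ∑ i ∈ s ∩ p.support, |p.coeff i| = ∑ i ∈ s, |p.coeff i| := by
    refine Finset.sum_subset Finset.inter_subset_left fun i hi hi' => ?_
    have : i ∉ p.support := fun h => hi' (Finset.mem_inter.2 ⟨hi, h⟩)
    rw [Polynomial.notMem_support_iff.1 this, abs_zero]
  rw [← h]
  exact Finset.sum_le_sum_of_subset_of_nonneg Finset.inter_subset_right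
    fun _ _ _ => abs_nonneg _

theorem coeffNorm_eq_sum_range {p : Polynomial ℝ} {N : ℕ} (h : p.natDegree < N) :
    coeffNorm p = ∑ i ∈ Finset.range N, |p.coeff i| := by
  refine Finset.sum_subset (fun i hi => ?_) fun i _ hi => ?_
  · exact Finset.mem_range.2 ((Polynomial.le_natDegree_of_mem_supp i hi).trans_lt h)
  · rw [Polynomial.notMem_support_iff.1 hi, abs_zero]

theorem abs_coeff_le_coeffNorm (p : Polynomial ℝ) (i : ℕ) : |p.coeff i| ≤ coeffNorm p := by
  simpa using sum_abs_coeff_le_coeffNorm p {i}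

theorem coeffNorm_add_le (p q : Polynomial ℝ) : coeffNorm (p + q) ≤ coeffNorm p + coeffNorm q :=
  calc coeffNorm (p + q) ≤ ∑ i ∈ (p + q).support, (|p.coeff i| + |q.coeff i|) :=
        Finset.sum_le_sum fun i _ => by rw [Polynomial.coeff_add]; exact abs_add_le _ _
    _ ≤ coeffNorm p + coeffNorm q := by
        rw [Finset.sum_add_distrib]
        exact add_le_add (sum_abs_coeff_le_coeffNorm p _) (sum_abs_coeff_le_coeffNorm q _)

theorem coeffNorm_monomial_mul_le (k : ℕ) (c : ℝ) (q : Polynomial ℝ) :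
    coeffNorm (Polynomial.monomial k c * q) ≤ |c| * coeffNorm q := by
  rw [coeffNorm_eq_sum_range (N := k + (q.natDegree + 1)), Finset.sum_range_add,
    Finset.sum_eq_zero, zero_add, coeffNorm_eq_sum_range (Nat.lt_succ_self _), Finset.mul_sum]
  · refine Finset.sum_le_sum fun i _ => ?_
    rw [add_comm k i, Polynomial.coeff_monomial_mul, abs_mul]
  · intro i hi
    rw [← Polynomial.C_mul_X_pow_eq_monomial, mul_assoc, Polynomial.coeff_C_mul,
      Polynomial.coeff_X_pow_mul', if_neg (by simpa using hi), mul_zero, abs_zero]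
  · have h1 := Polynomial.natDegree_mul_le (p := Polynomial.monomial k c) (q := q)
    have h2 := Polynomial.natDegree_monomial_le c (m := k)
    omega

theorem coeffNorm_sum_le {ι : Type*} (s : Finset ι) (f : ι → Polynomial ℝ) :
    coeffNorm (∑ i ∈ s, f i) ≤ ∑ i ∈ s, coeffNorm (f i) := by
  classical
  induction s using Finset.induction_on with
  | empty => simp [coeffNorm]
  | insert a s ha ih =>
    rw [Finset.sum_insert ha, Finset.sum_insert ha]
    exact (coeffNorm_add_le _ _).trans (by gcongr)

theorem coeffNorm_mul_le (p q : Polynomial ℝ) : coeffNorm (p * q) ≤ coeffNorm p * coeffNorm q := by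
  conv_lhs => rw [p.as_sum_support, Finset.sum_mul]
  refine (coeffNorm_sum_le _ _).trans ?_
  conv_rhs => rw [coeffNorm, Finset.sum_mul]
  exact Finset.sum_le_sum fun i _ => coeffNorm_monomial_mul_le _ _ _

theorem coeffNorm_one_add_X_pow_le (s : ℕ) : coeffNorm ((1 + Polynomial.X) ^ s) ≤ 2 ^ s := by
  rw [coeffNorm_eq_sum_range (N := s + 1)]
  · simp only [Polynomial.coeff_one_add_X_pow, Nat.abs_cast]
    rw [← Nat.cast_sum, Nat.sum_range_choose]
    simp
  · rw [Nat.lt_succ_iff]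
    refine Polynomial.natDegree_pow_le_of_le s ?_ |>.trans (mul_one s).le
    refine (Polynomial.natDegree_add_le _ _).trans ?_
    simp

theorem coeff_one_sub_X_mul_succ (p : Polynomial ℝ) (u : ℕ) :
    ((1 - Polynomial.X) * p).coeff (u + 1) = p.coeff (u + 1) - p.coeff u := by
  rw [sub_mul, one_mul, Polynomial.coeff_sub, Polynomial.coeff_X_mul]

theorem coeff_one_sub_X_mul_zero (p : Polynomial ℝ) :
    ((1 - Polynomial.X) * p).coeff 0 = p.coeff 0 := by
  simp [sub_mul]

theorem sum_coeff_one_sub_X_mul (p : Polynomial ℝ) (u : ℕ) :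
    ∑ v ∈ Finset.range (u + 1), ((1 - Polynomial.X) * p).coeff v = p.coeff u := by
  rw [Finset.sum_range_succ', coeff_one_sub_X_mul_zero]
  simp only [coeff_one_sub_X_mul_succ]
  rw [Finset.sum_range_sub, sub_add_cancel]

/-- The coefficients of `p` are the partial sums of those of `(1 - X) p`. -/
theorem abs_coeff_le_coeffNorm_one_sub_X_mul (p : Polynomial ℝ) (u : ℕ) :
    |p.coeff u| ≤ coeffNorm ((1 - Polynomial.X) * p) := by
  rw [← sum_coeff_one_sub_X_mul]
  exact (Finset.abs_sum_le_sum_abs _ _).trans (sum_abs_coeff_le_coeffNorm _ _)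

/-! ### Differences of binomial coefficients -/

theorem succ_mul_coeff_one_sub_X_mul_one_add_X_pow (a u : ℕ) :
    ((a : ℝ) + 1) * ((1 - Polynomial.X) * (1 + Polynomial.X) ^ a : Polynomial ℝ).coeff u =
      (a + 1).choose u * ((a : ℝ) + 1 - 2 * u) := by
  cases u with
  | zero => simp [sub_mul, Polynomial.coeff_one_add_X_pow]
  | succ u =>
    rw [coeff_one_sub_X_mul_succ, Polynomial.coeff_one_add_X_pow, Polynomial.coeff_one_add_X_pow]
    have h1 : ((a : ℝ) + 1) * a.choose u = (a + 1).choose (u + 1) * ((u : ℝ) + 1) := by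
      exact_mod_cast Nat.add_one_mul_choose_eq a u
    have h2 : (((a + 1).choose (u + 1) : ℕ) : ℝ) = a.choose u + a.choose (u + 1) := by
      exact_mod_cast Nat.choose_succ_succ a u
    push_cast
    linear_combination (-2) * h1 - ((a : ℝ) + 1) * h2

/-- This is the variance of a symmetric binomial law, read off from the Bernstein polynomials at `1
/ 2`. -/
theorem sum_choose_mul_sq (b : ℕ) :
    ∑ u ∈ Finset.range (b + 1), (b.choose u : ℝ) * ((b : ℝ) - 2 * u) ^ 2 = (b : ℝ) * 2 ^ b := by
  have h := congrArg (Polynomial.eval (1 / 2 : ℝ)) (bernsteinPolynomial.variance ℝ b)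
  simp only [bernsteinPolynomial, Polynomial.eval_finsetSum, Polynomial.eval_mul,
    Polynomial.eval_pow, Polynomial.eval_sub, Polynomial.eval_X,
    Polynomial.eval_natCast, Polynomial.eval_one, nsmul_eq_mul] at h
  have h2 : ∑ u ∈ Finset.range (b + 1), (b.choose u : ℝ) * ((b : ℝ) - 2 * u) ^ 2 =
      4 * 2 ^ b * ∑ u ∈ Finset.range (b + 1), ((b : ℝ) * (1 / 2) - u) ^ 2 *
        (b.choose u * (1 / 2) ^ u * (1 - 1 / 2) ^ (b - u)) := by
    rw [Finset.mul_sum]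
    refine Finset.sum_congr rfl fun u hu => ?_
    have hu : u ≤ b := by simpa [Nat.lt_succ_iff] using hu
    have h3 : (2 : ℝ) ^ b * ((1 / 2) ^ u * (1 - 1 / 2) ^ (b - u)) = 1 := by
      rw [show (1 - 1 / 2 : ℝ) = 1 / 2 by norm_num, ← pow_add, Nat.add_sub_cancel' hu,
        ← mul_pow]
      norm_num
    linear_combination -(b.choose u : ℝ) * (b - 2 * u) ^ 2 * h3
  rw [h2, h]
  ring

/-- Up to the factor `a + 1`, the norm is the mean absolute deviation of a binomial law, scaled by
its total mass. Cauchy–Schwarz bounds it by the variance. -/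
theorem sq_coeffNorm_one_sub_X_mul_one_add_X_pow_le (a : ℕ) :
    coeffNorm ((1 - Polynomial.X) * (1 + Polynomial.X) ^ a) ^ 2 * ((a : ℝ) + 1) ≤ 4 ^ (a + 1) := by
  set e : Polynomial ℝ := (1 - Polynomial.X) * (1 + Polynomial.X) ^ a with he
  have hpos : (0 : ℝ) < (a : ℝ) + 1 := by positivity
  have hdeg : e.natDegree < a + 1 + 1 := by
    have h1 : (1 - Polynomial.X : Polynomial ℝ).natDegree ≤ 1 :=
      (Polynomial.natDegree_sub_le _ _).trans (by simp)
    have h2 : (1 + Polynomial.X : Polynomial ℝ).natDegree ≤ 1 :=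
      (Polynomial.natDegree_add_le _ _).trans (by simp)
    have h3 := Polynomial.natDegree_pow_le_of_le a h2
    have h4 := Polynomial.natDegree_mul_le (p := (1 - Polynomial.X : Polynomial ℝ))
      (q := (1 + Polynomial.X) ^ a)
    rw [← he] at h4
    omega
  have hnorm : ((a : ℝ) + 1) * coeffNorm e =
      ∑ u ∈ Finset.range (a + 1 + 1), √((a + 1).choose u) *
        (√((a + 1).choose u) * |((a + 1 : ℕ) : ℝ) - 2 * u|) := by
    rw [coeffNorm_eq_sum_range hdeg, Finset.mul_sum]
    refine Finset.sum_congr rfl fun u _ => ?_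
    rw [← mul_assoc, Real.mul_self_sqrt (by positivity), ← abs_of_pos hpos, ← abs_mul, he,
      succ_mul_coeff_one_sub_X_mul_one_add_X_pow, abs_mul, Nat.abs_cast]
    push_cast
    rfl
  have hcs := Finset.sum_mul_sq_le_sq_mul_sq (Finset.range (a + 1 + 1))
    (fun u => √((a + 1).choose u : ℝ))
    (fun u => √((a + 1).choose u : ℝ) * |((a + 1 : ℕ) : ℝ) - 2 * u|)
  simp only [mul_pow, sq_abs, Real.sq_sqrt (Nat.cast_nonneg _)] at hcs
  rw [← hnorm, sum_choose_mul_sq, ← Nat.cast_sum, Nat.sum_range_choose] at hcs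
  push_cast at hcs
  have h4 : (4 : ℝ) ^ (a + 1) = 2 ^ (a + 1) * 2 ^ (a + 1) := by rw [← mul_pow]; norm_num
  rw [h4]
  refine le_of_mul_le_mul_left ?_ hpos
  linarith

/-- The third differences of the binomial coefficients are small in total. -/
theorem coeffNorm_one_sub_X_pow_three_mul_le {n : ℕ} (hn : 1 ≤ n) :
    coeffNorm ((1 - Polynomial.X) ^ 2 * ((1 - Polynomial.X) * (1 + Polynomial.X) ^ n)) ≤
      72 * (2 ^ n / (n * √n)) := by
  set a := n / 3 with ha
  set s := n % 3 with hs
  have hn3 : n = a + a + a + s := by omega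
  set x := coeffNorm ((1 - Polynomial.X) * (1 + Polynomial.X) ^ a) with hx
  have hx0 : 0 ≤ x := coeffNorm_nonneg _
  have hprod : coeffNorm ((1 - Polynomial.X) ^ 2 * ((1 - Polynomial.X) *
      (1 + Polynomial.X) ^ n)) ≤ x * x * x * 2 ^ s := by
    have : ((1 - Polynomial.X) ^ 2 * ((1 - Polynomial.X) * (1 + Polynomial.X) ^ n) :
        Polynomial ℝ) = ((1 - Polynomial.X) * (1 + Polynomial.X) ^ a) *
        ((1 - Polynomial.X) * (1 + Polynomial.X) ^ a) *
        ((1 - Polynomial.X) * (1 + Polynomial.X) ^ a) * (1 + Polynomial.X) ^ s := by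
      rw [hn3, pow_add, pow_add, pow_add]
      ring
    rw [this]
    refine (coeffNorm_mul_le _ _).trans (mul_le_mul ?_ (coeffNorm_one_add_X_pow_le s)
      (coeffNorm_nonneg _) (by positivity))
    refine (coeffNorm_mul_le _ _).trans (mul_le_mul_of_nonneg_right ?_ hx0)
    exact coeffNorm_mul_le _ _
  refine hprod.trans ?_
  have hn0 : (0 : ℝ) < n := by exact_mod_cast hn
  have hsq : 0 < √(n : ℝ) := Real.sqrt_pos.2 hn0
  have hsqn : √(n : ℝ) ^ 2 = n := Real.sq_sqrt hn0.le
  have hna : (n : ℝ) ≤ 3 * (a + 1) := by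
    have : n ≤ 3 * (a + 1) := by omega
    exact_mod_cast this
  have hxle : x * √n ≤ 4 * 2 ^ a := by
    have h1 := sq_coeffNorm_one_sub_X_mul_one_add_X_pow_le a
    rw [← hx] at h1
    have h4 : (4 : ℝ) ^ (a + 1) = 4 * (2 ^ a) ^ 2 := by
      rw [pow_succ, ← pow_mul, mul_comm a 2, pow_mul]
      norm_num [mul_comm]
    refine le_of_sq_le_sq ?_ (by positivity)
    rw [mul_pow, hsqn, mul_pow]
    nlinarith [sq_nonneg x, sq_nonneg ((2 : ℝ) ^ a), mul_le_mul_of_nonneg_left hna (sq_nonneg x)]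
  have h3 : (x * √n) ^ 3 ≤ (4 * 2 ^ a) ^ 3 := pow_le_pow_left₀ (by positivity) hxle 3
  have h2n : (2 : ℝ) ^ n = (2 ^ a) ^ 3 * 2 ^ s := by
    conv_lhs => rw [hn3]
    rw [pow_add, pow_add, pow_add]
    ring
  rw [← mul_div_assoc, le_div_iff₀ (by positivity), h2n]
  have h5 : x * x * x * 2 ^ s * (n * √n) = (x * √n) ^ 3 * 2 ^ s := by
    rw [mul_pow, pow_succ (√(n : ℝ)) 2, hsqn]
    ring
  rw [h5]
  have h6 : (0 : ℝ) < 2 ^ s := by positivity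
  have h7 : (0 : ℝ) ≤ (2 ^ a) ^ 3 := by positivity
  calc (x * √n) ^ 3 * 2 ^ s ≤ (4 * 2 ^ a) ^ 3 * 2 ^ s := by gcongr
    -- The cube gives `64`; the constant `72` leaves room.
    _ ≤ 72 * ((2 ^ a) ^ 3 * 2 ^ s) := by nlinarith [mul_nonneg h7 h6.le]

/-! ### Summation against periodic weights -/

theorem sum_range_mul_by_parts (f e : ℕ → ℝ) (N : ℕ) :
    ∑ u ∈ Finset.range N, f u * e u =
      (∑ v ∈ Finset.range N, f v) * e N -
        ∑ u ∈ Finset.range N, (∑ v ∈ Finset.range (u + 1), f v) * (e (u + 1) - e u) := by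
  induction N with
  | zero => simp
  | succ N ih =>
    rw [Finset.sum_range_succ, ih, Finset.sum_range_succ (fun u => _ * (e (u + 1) - e u)),
      Finset.sum_range_succ f N]
    ring

theorem sum_range_periodic {f : ℕ → ℝ} {ℓ : ℕ} (hf : ∀ u, f (u + ℓ) = f u)
    (h0 : ∑ u ∈ Finset.range ℓ, f u = 0) (N : ℕ) :
    ∑ u ∈ Finset.range (N + ℓ), f u = ∑ u ∈ Finset.range N, f u := by
  rw [add_comm, Finset.sum_range_add, h0, zero_add]
  exact Finset.sum_congr rfl fun u _ => by rw [add_comm, hf]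

/-- Full periods cancel, leaving fewer than `ℓ` terms. -/
theorem abs_sum_range_periodic_le {f : ℕ → ℝ} {ℓ : ℕ} {c : ℝ} (hℓ : 0 < ℓ)
    (hf : ∀ u, f (u + ℓ) = f u) (h0 : ∑ u ∈ Finset.range ℓ, f u = 0) (hc : ∀ u, |f u| ≤ c)
    (N : ℕ) : |∑ u ∈ Finset.range N, f u| ≤ ℓ * c := by
  have hmod : ∑ u ∈ Finset.range N, f u = ∑ u ∈ Finset.range (N % ℓ), f u := by
    induction N using Nat.strong_induction_on with
    | _ N ih =>
      rcases lt_or_ge N ℓ with h | h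
      · rw [Nat.mod_eq_of_lt h]
      · obtain ⟨M, rfl⟩ := Nat.exists_eq_add_of_le' h
        rw [sum_range_periodic hf h0, ih M (by omega), Nat.add_mod_right]
  have hc0 : 0 ≤ c := (abs_nonneg _).trans (hc 0)
  rw [hmod]
  calc |∑ u ∈ Finset.range (N % ℓ), f u| ≤ ∑ u ∈ Finset.range (N % ℓ), |f u| :=
        Finset.abs_sum_le_sum_abs _ _
    _ ≤ ∑ _u ∈ Finset.range (N % ℓ), c := Finset.sum_le_sum fun u _ => hc u
    _ = (N % ℓ : ℕ) * c := by simp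
    _ ≤ ℓ * c := by
        have : N % ℓ ≤ ℓ := (Nat.mod_lt N hℓ).le
        gcongr

/-- Summation by parts, applied twice, bounds a sum of the coefficients of `p` against a periodic
weight of mean zero by the coefficients of `(1 - X)² p`. -/
theorem abs_sum_periodic_mul_coeff_le {h : ℕ → ℝ} {ℓ : ℕ} {c : ℝ} (hℓ : 0 < ℓ)
    (hper : ∀ u, h (u + ℓ) = h u) (h0 : ∑ u ∈ Finset.range ℓ, h u = 0) (hc : ∀ u, |h u| ≤ c)
    (p : Polynomial ℝ) (N : ℕ)
    (hN : |p.coeff N| ≤ coeffNorm ((1 - Polynomial.X) ^ 2 * p)) :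
    |∑ u ∈ Finset.range N, h u * p.coeff u| ≤
      7 * ℓ ^ 2 * c * coeffNorm ((1 - Polynomial.X) ^ 2 * p) := by
  set L := coeffNorm ((1 - Polynomial.X) ^ 2 * p) with hL
  have hsq : ((1 - Polynomial.X) ^ 2 * p : Polynomial ℝ) =
      (1 - Polynomial.X) * ((1 - Polynomial.X) * p) := by ring
  have hc0 : 0 ≤ c := (abs_nonneg _).trans (hc 0)
  have hL0 : 0 ≤ L := coeffNorm_nonneg _
  have hℓ1 : (1 : ℝ) ≤ ℓ := by exact_mod_cast hℓ
  have hℓ0 : (ℓ : ℝ) ≠ 0 := by positivity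
  set F : ℕ → ℝ := fun u => ∑ v ∈ Finset.range u, h v with hF
  have hFle : ∀ u, |F u| ≤ ℓ * c := abs_sum_range_periodic_le hℓ hper h0 hc
  have hFper : ∀ u, F (u + ℓ) = F u := sum_range_periodic hper h0
  -- The partial sums `F` are periodic but need not have mean zero. Subtracting their mean permits a
  -- second summation by parts; the mean itself only meets a telescoping sum.
  set m : ℝ := (∑ u ∈ Finset.range ℓ, F (u + 1)) / ℓ with hm
  have hmle : |m| ≤ ℓ * c := by
    rw [hm, abs_div, Nat.abs_cast, div_le_iff₀ (by positivity)]
    calc |∑ u ∈ Finset.range ℓ, F (u + 1)| ≤ ∑ u ∈ Finset.range ℓ, |F (u + 1)| :=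
          Finset.abs_sum_le_sum_abs _ _
      _ ≤ ∑ _u ∈ Finset.range ℓ, ℓ * c := Finset.sum_le_sum fun u _ => hFle _
      _ = ℓ * c * ℓ := by simp; ring
  set g : ℕ → ℝ := fun u => F (u + 1) - m with hg
  have hgper : ∀ u, g (u + ℓ) = g u := fun u => by
    simp only [hg]
    rw [add_right_comm, hFper]
  have hg0 : ∑ u ∈ Finset.range ℓ, g u = 0 := by
    simp only [hg, Finset.sum_sub_distrib, Finset.sum_const, Finset.card_range, nsmul_eq_mul]
    rw [hm, mul_div_cancel₀ _ hℓ0, sub_self]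
  have hgle : ∀ u, |g u| ≤ 2 * (ℓ * c) := fun u => by
    have := abs_sub (F (u + 1)) m
    have h1 := hFle (u + 1)
    simp only [hg]
    linarith
  have hGle := abs_sum_range_periodic_le hℓ hgper hg0 hgle
  set d : ℕ → ℝ := fun u => p.coeff (u + 1) - p.coeff u with hd
  have hdeq : ∀ u, d u = ((1 - Polynomial.X) * p).coeff (u + 1) := fun u =>
    (coeff_one_sub_X_mul_succ p u).symm
  have hdle : ∀ u, |d u| ≤ L := fun u => by
    rw [hdeq, hL, hsq]
    exact abs_coeff_le_coeffNorm_one_sub_X_mul _ _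
  have hp0 : |p.coeff 0| ≤ L := by
    have := abs_coeff_le_coeffNorm ((1 - Polynomial.X) ^ 2 * p) 0
    rwa [hsq, coeff_one_sub_X_mul_zero, coeff_one_sub_X_mul_zero, ← hsq] at this
  have hFsum : ∑ u ∈ Finset.range N, F (u + 1) * d u =
      ∑ u ∈ Finset.range N, g u * d u + m * (p.coeff N - p.coeff 0) := by
    rw [← Finset.sum_range_sub (fun u => p.coeff u), Finset.mul_sum, ← Finset.sum_add_distrib]
    refine Finset.sum_congr rfl fun u _ => ?_
    simp only [hg, hd]
    ring
  have hsecond : |∑ u ∈ Finset.range N, g u * d u| ≤ 2 * (ℓ * (2 * (ℓ * c)) * L) := by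
    rw [sum_range_mul_by_parts]
    have h1 : |(∑ v ∈ Finset.range N, g v) * d N| ≤ ℓ * (2 * (ℓ * c)) * L := by
      rw [abs_mul]
      exact mul_le_mul (hGle N) (hdle N) (abs_nonneg _) (by positivity)
    have h2 : |∑ u ∈ Finset.range N, (∑ v ∈ Finset.range (u + 1), g v) * (d (u + 1) - d u)| ≤
        ℓ * (2 * (ℓ * c)) * L := by
      refine (Finset.abs_sum_le_sum_abs _ _).trans ?_
      have h3 : ∑ u ∈ Finset.range N, |d (u + 1) - d u| ≤ L := by
        have h4 : ∀ u, d (u + 1) - d u = ((1 - Polynomial.X) ^ 2 * p).coeff (u + 2) := by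
          intro u
          rw [hsq, coeff_one_sub_X_mul_succ, hdeq, hdeq]
        simp only [h4]
        have h5 := sum_abs_coeff_le_coeffNorm ((1 - Polynomial.X) ^ 2 * p)
          ((Finset.range N).map (addRightEmbedding 2))
        rwa [Finset.sum_map] at h5
      calc ∑ u ∈ Finset.range N, |(∑ v ∈ Finset.range (u + 1), g v) * (d (u + 1) - d u)| ≤
          ∑ u ∈ Finset.range N, ℓ * (2 * (ℓ * c)) * |d (u + 1) - d u| := by
            refine Finset.sum_le_sum fun u _ => ?_
            rw [abs_mul]
            exact mul_le_mul_of_nonneg_right (hGle _) (abs_nonneg _)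
        _ ≤ ℓ * (2 * (ℓ * c)) * L := by
            rw [← Finset.mul_sum]
            exact mul_le_mul_of_nonneg_left h3 (by positivity)
    have := abs_sub ((∑ v ∈ Finset.range N, g v) * d N)
      (∑ u ∈ Finset.range N, (∑ v ∈ Finset.range (u + 1), g v) * (d (u + 1) - d u))
    linarith
  have hmain : ∑ u ∈ Finset.range N, h u * p.coeff u =
      (F N - m) * p.coeff N + m * p.coeff 0 - ∑ u ∈ Finset.range N, g u * d u := by
    rw [sum_range_mul_by_parts]
    change F N * p.coeff N - ∑ u ∈ Finset.range N, F (u + 1) * d u = _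
    rw [hFsum]
    ring
  have hb1 : |(F N - m) * p.coeff N| ≤ 2 * (ℓ * c) * L := by
    rw [abs_mul]
    refine mul_le_mul ?_ hN (abs_nonneg _) (by positivity)
    have := abs_sub (F N) m
    linarith [hFle N]
  have hb2 : |m * p.coeff 0| ≤ ℓ * c * L := by
    rw [abs_mul]
    exact mul_le_mul hmle hp0 (abs_nonneg _) (by positivity)
  have hcL : 0 ≤ c * L := mul_nonneg hc0 hL0
  have hℓsq : (ℓ : ℝ) * (c * L) ≤ ℓ ^ 2 * (c * L) :=
    mul_le_mul_of_nonneg_right (by nlinarith) hcL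
  -- The three pieces cost `2ℓ`, `ℓ` and `4ℓ²` times `c * L`, whence the constant `7ℓ²`.
  rw [hmain]
  have t1 := abs_sub ((F N - m) * p.coeff N + m * p.coeff 0) (∑ u ∈ Finset.range N, g u * d u)
  have t2 := abs_add_le ((F N - m) * p.coeff N) (m * p.coeff 0)
  nlinarith

/-! ### The modular walk numbers up to a small error -/

/-- A walk to `n - 2u` has `u` down-steps from `0` and `u - 1` from `-2`, so the value is `C(n, u) -
C(n, u - 1)`. -/
theorem signedWalks_eq_coeff (n u : ℕ) :
    (signedWalks n (n - 2 * u) : ℝ) =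
      ((1 - Polynomial.X) * (1 + Polynomial.X) ^ n : Polynomial ℝ).coeff u := by
  induction n generalizing u with
  | zero =>
    rcases u with _ | _ | u
    · simp [signedWalks]
    · simp [signedWalks, Polynomial.coeff_one]
    · have h1 : ((0 : ℕ) : ℤ) - 2 * ((u + 1 + 1 : ℕ) : ℤ) ≠ 0 := by omega
      have h2 : ((0 : ℕ) : ℤ) - 2 * ((u + 1 + 1 : ℕ) : ℤ) ≠ -2 := by omega
      simp only [signedWalks]
      rw [if_neg h1, if_neg h2]
      simp [Polynomial.coeff_one, Polynomial.coeff_X]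
  | succ n ih =>
    rw [pow_succ, ← mul_assoc, mul_add, mul_one, Polynomial.coeff_add]
    simp only [signedWalks]
    cases u with
    | zero =>
      rw [Polynomial.coeff_mul_X_zero, add_zero, ← ih, signedWalks_eq_zero_of_lt (x := _ + 1)]
      · push_cast
        ring_nf
      · push_cast
        linarith
    | succ u =>
      rw [Polynomial.coeff_mul_X, ← ih, ← ih]
      push_cast
      ring_nf

theorem sum_range_eq_sum_half {R : Type*} [AddCommMonoid R] (n : ℕ) (h : ℤ → R)
    (hodd : ∀ x : ℤ, Odd ((n : ℤ) - x) → h x = 0) :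
    ∑ x ∈ Finset.range (n + 1), h x = ∑ u ∈ Finset.range (n / 2 + 1), h (n - 2 * u) := by
  rw [← Finset.sum_range_reflect]
  symm
  refine Finset.sum_of_injOn (fun u => 2 * u) (fun a _ b _ hab => by simpa using hab)
    (fun u hu => ?_) (fun y hy hy' => ?_) (fun u hu => ?_)
  · simp only [Finset.coe_range, Set.mem_Iio] at hu ⊢
    omega
  · simp only [Finset.mem_range] at hy
    apply hodd
    rcases Nat.even_or_odd' y with ⟨c, rfl | rfl⟩
    · exact absurd ⟨c, by simp; omega, rfl⟩ hy'
    · exact ⟨c, by omega⟩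
  · simp only [Finset.mem_range] at hu
    congr 1
    omega

theorem modWalkCount_eq_sum_coeff {ℓ : ℕ} (n : ℕ) (hℓ : 2 ≤ ℓ) :
    (modWalkCount ℓ n : ℝ) =
      ∑ u ∈ Finset.range (n / 2 + 1), (residueWeight ℓ (n - 2 * u) : ℝ) *
        ((1 - Polynomial.X) * (1 + Polynomial.X) ^ n : Polynomial ℝ).coeff u := by
  have h := congrArg (Int.cast : ℤ → ℝ) (modWalkCount_eq_sum_residueWeight n hℓ)
  rw [sum_range_eq_sum_half n (fun x => residueWeight ℓ x * signedWalks n x)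
    fun x hx => by rw [signedWalks_eq_zero_of_odd hx, mul_zero]] at h
  rw [Int.cast_natCast] at h
  rw [h, Int.cast_sum]
  refine Finset.sum_congr rfl fun u _ => ?_
  rw [Int.cast_mul, signedWalks_eq_coeff]

/-- This controls the boundary term of the summation by parts. The index corresponds to `x = -1` for
odd `n`, where the coefficient vanishes, and to `x = -2` for even `n`, where antisymmetry makes it
half of a difference of neighbours. -/
theorem abs_coeff_succ_half_le (n : ℕ) :
    |((1 - Polynomial.X) * (1 + Polynomial.X) ^ n : Polynomial ℝ).coeff (n / 2 + 1)| ≤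
      coeffNorm ((1 - Polynomial.X) ^ 2 * ((1 - Polynomial.X) * (1 + Polynomial.X) ^ n)) := by
  set p : Polynomial ℝ := (1 - Polynomial.X) * (1 + Polynomial.X) ^ n with hp
  rcases Nat.even_or_odd' n with ⟨c, hc | hc⟩
  · have h1 : p.coeff (n / 2 + 1) = -p.coeff (n / 2) := by
      rw [hp, ← signedWalks_eq_coeff, ← signedWalks_eq_coeff, ← Int.cast_neg,
        ← signedWalks_reflect]
      congr 2
      push_cast
      omega
    have h2 := abs_coeff_le_coeffNorm_one_sub_X_mul ((1 - Polynomial.X) * p) (n / 2 + 1)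
    rw [coeff_one_sub_X_mul_succ, ← mul_assoc, ← pow_two,
      show p.coeff (n / 2) = -p.coeff (n / 2 + 1) by rw [h1, neg_neg], sub_neg_eq_add, ← two_mul,
      abs_mul, abs_two] at h2
    linarith [abs_nonneg (p.coeff (n / 2 + 1))]
  · have h1 : p.coeff (n / 2 + 1) = 0 := by
      rw [hp, ← signedWalks_eq_coeff, show (n : ℤ) - 2 * ((n / 2 + 1 : ℕ) : ℤ) = -1 by omega,
        signedWalks_neg_one, Int.cast_zero]
    rw [h1, abs_zero]
    exact coeffNorm_nonneg _

/-- The number of `u < ℓ` with `residueWeight ℓ (n - 2 * u) = 1`. -/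
theorem sum_residueWeight (ℓ n : ℕ) (hℓ : 2 ≤ ℓ) :
    ∑ u ∈ Finset.range ℓ, residueWeight ℓ (n - 2 * u) =
      if Odd n then ((ℓ / 2 + 1 : ℕ) : ℤ) else (((ℓ + 1) / 2 : ℕ) : ℤ) := by
  -- The sum runs over a full period, so it depends only on the parity of `x`.
  have hshift : ∀ x : ℤ, ∑ u ∈ Finset.range ℓ, residueWeight ℓ (x + 2 - 2 * u) =
      ∑ u ∈ Finset.range ℓ, residueWeight ℓ (x - 2 * u) := by
    intro x
    have h1 := Finset.sum_range_succ (fun u : ℕ => residueWeight ℓ (x + 2 - 2 * u)) ℓ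
    rw [Finset.sum_range_succ', ← residueWeight_add_period ℓ (x + 2 - 2 * (ℓ : ℕ)) 1] at h1
    rw [show (2 * (ℓ : ℤ) * 1 + (x + 2 - 2 * ℓ)) = x + 2 - 2 * (0 : ℕ) by push_cast; ring] at h1
    rw [← add_right_cancel h1]
    refine Finset.sum_congr rfl fun u _ => ?_
    congr 1
    push_cast
    ring
  have hshifts : ∀ (k : ℕ) (x : ℤ), ∑ u ∈ Finset.range ℓ, residueWeight ℓ (x + 2 * k - 2 * u) =
      ∑ u ∈ Finset.range ℓ, residueWeight ℓ (x - 2 * u) := by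
    intro k x
    induction k with
    | zero => simp
    | succ k ih =>
      rw [← ih, ← hshift (x + 2 * k)]
      refine Finset.sum_congr rfl fun u _ => ?_
      congr 1
      push_cast
      ring
  have hcount : ∀ y : ℤ, ∀ c : ℕ, c ≤ ℓ → 0 ≤ y → y < 2 →
      -- With this representative of the parity class, `x + 1` runs through `2u + y` in `[0, 2ℓ)`,
      -- where no reduction modulo `2ℓ` occurs.
      (∀ u : ℕ, u < ℓ → (2 * u + y ≤ ℓ ↔ u < c)) →
      ∑ u ∈ Finset.range ℓ, residueWeight ℓ (y - 1 + 2 * ((ℓ - 1 : ℕ) : ℤ) - 2 * u) = c := by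
    intro y c hcl hy0 hy2 hu
    rw [← Finset.sum_range_reflect]
    have : ∀ u ∈ Finset.range ℓ, residueWeight ℓ
        (y - 1 + 2 * ((ℓ - 1 : ℕ) : ℤ) - 2 * ((ℓ - 1 - u : ℕ) : ℤ)) =
        if u < c then 1 else 0 := by
      intro u hul
      have hul := Finset.mem_range.1 hul
      rw [show y - 1 + 2 * ((ℓ - 1 : ℕ) : ℤ) - 2 * ((ℓ - 1 - u : ℕ) : ℤ) = 2 * u + y - 1 by omega]
      rw [residueWeight, sub_add_cancel, Int.emod_eq_of_lt (by omega) (by omega)]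
      simp only [hu u hul]
    rw [Finset.sum_congr rfl this, Finset.sum_ite, Finset.sum_const_zero, add_zero,
      Finset.sum_const, nsmul_eq_mul, mul_one]
    have : (Finset.range ℓ).filter (fun u => u < c) = Finset.range c := by
      ext u
      simp only [Finset.mem_filter, Finset.mem_range]
      omega
    rw [this, Finset.card_range]
  rcases Nat.even_or_odd' n with ⟨k, hk | hk⟩
  · rw [if_neg (by rw [Nat.not_odd_iff_even]; exact ⟨k, by omega⟩)]
    rw [← hcount 1 ((ℓ + 1) / 2) (by omega) (by omega) (by omega) (by intro u _; omega),
      hshifts, show (n : ℤ) = 1 - 1 + 2 * k by omega, hshifts]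
  · rw [if_pos ⟨k, hk⟩]
    rw [← hcount 0 (ℓ / 2 + 1) (by omega) (by omega) (by omega) (by intro u _; omega),
      hshifts, show (n : ℤ) = 0 - 1 + 2 * ((k + 1 : ℕ) : ℤ) by push_cast; omega, hshifts]

/-- The factor in `modWalkAsymp`. -/
noncomputable def modWalkDensity (ℓ n : ℕ) : ℝ :=
  if Odd ℓ then ((ℓ : ℝ) + 1) / (2 * ℓ) else ((ℓ : ℝ) + 1 + (-1) ^ (n + 1)) / (2 * ℓ)

theorem sum_residueWeight_eq_density (ℓ n : ℕ) (hℓ : 2 ≤ ℓ) :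
    ∑ u ∈ Finset.range ℓ, (residueWeight ℓ (n - 2 * u) : ℝ) = ℓ * modWalkDensity ℓ n := by
  have h := congrArg (Int.cast : ℤ → ℝ) (sum_residueWeight ℓ n hℓ)
  rw [Int.cast_sum] at h
  rw [h, modWalkDensity]
  have hℓ0 : (ℓ : ℝ) ≠ 0 := by positivity
  rcases Nat.even_or_odd' ℓ with ⟨k, hk | hk⟩
  · have hℓodd : ¬ Odd ℓ := by rw [Nat.not_odd_iff_even]; exact ⟨k, by omega⟩
    rw [if_neg hℓodd]
    split_ifs with hn
    · rw [hn.add_one.neg_one_pow, show ℓ / 2 + 1 = k + 1 by omega]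
      have : (ℓ : ℝ) = 2 * k := by exact_mod_cast hk
      field_simp
      push_cast
      linarith
    · rw [(Nat.not_odd_iff_even.1 hn).add_one.neg_one_pow, show (ℓ + 1) / 2 = k by omega]
      have : (ℓ : ℝ) = 2 * k := by exact_mod_cast hk
      field_simp
      push_cast
      linarith
  · have hℓodd : Odd ℓ := ⟨k, hk⟩
    rw [if_pos hℓodd, show ℓ / 2 + 1 = k + 1 by omega, show (ℓ + 1) / 2 = k + 1 by omega,
      ite_self]
    have : (ℓ : ℝ) = 2 * k + 1 := by exact_mod_cast hk
    field_simp
    push_cast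
    linarith

/-- The upper bound keeps the centred weight within `[-1, 1]`; the lower one keeps the asymptotic
formula of exact order `2^n / √n`. -/
theorem modWalkDensity_mem {ℓ : ℕ} (n : ℕ) (hℓ : 2 ≤ ℓ) :
    1 / 2 ≤ modWalkDensity ℓ n ∧ modWalkDensity ℓ n ≤ 1 := by
  have h2 : (2 : ℝ) ≤ ℓ := by exact_mod_cast hℓ
  rw [modWalkDensity]
  split_ifs
  · constructor
    · rw [div_le_div_iff₀ (by positivity) (by positivity)]
      linarith
    · rw [div_le_one (by positivity)]
      linarith
  · rcases neg_one_pow_eq_or ℝ (n + 1) with h | h <;> rw [h] <;> constructor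
    · rw [div_le_div_iff₀ (by positivity) (by positivity)]
      linarith
    · rw [div_le_one (by positivity)]
      linarith
    · rw [div_le_div_iff₀ (by positivity) (by positivity)]
      linarith
    · rw [div_le_one (by positivity)]
      linarith

/-- The mean of the weight gives the main term, the centred weight the error; `504 = 7 · 72`. -/
theorem abs_modWalkCount_sub_density_mul_choose_le {ℓ n : ℕ} (hℓ : 2 ≤ ℓ) (hn : 1 ≤ n) :
    |(modWalkCount ℓ n : ℝ) - modWalkDensity ℓ n * n.choose (n / 2)| ≤
      504 * ℓ ^ 2 * (2 ^ n / (n * √n)) := by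
  obtain ⟨hd1, hd2⟩ := modWalkDensity_mem n hℓ
  have hN := abs_coeff_succ_half_le n
  set h : ℕ → ℝ := fun u => (residueWeight ℓ (n - 2 * u) : ℝ) - modWalkDensity ℓ n with hh
  have hper : ∀ u, h (u + ℓ) = h u := fun u => by
    simp only [hh]
    rw [← residueWeight_add_period ℓ ((n : ℤ) - 2 * (u + ℓ : ℕ)) 1]
    congr 3
    push_cast
    ring
  have h0 : ∑ u ∈ Finset.range ℓ, h u = 0 := by
    simp only [hh, Finset.sum_sub_distrib, sum_residueWeight_eq_density ℓ n hℓ, Finset.sum_const,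
      Finset.card_range, nsmul_eq_mul, sub_self]
  have hc : ∀ u, |h u| ≤ 1 := fun u => by
    simp only [hh, residueWeight]
    rw [abs_le]
    split_ifs <;> push_cast <;> constructor <;> linarith
  have hmain := abs_sum_periodic_mul_coeff_le (by omega) hper h0 hc _ _ hN
  have heq : ∑ u ∈ Finset.range (n / 2 + 1), h u *
      ((1 - Polynomial.X) * (1 + Polynomial.X) ^ n : Polynomial ℝ).coeff u =
      (modWalkCount ℓ n : ℝ) - modWalkDensity ℓ n * n.choose (n / 2) := by
    simp only [hh, sub_mul (_ : ℝ), Finset.sum_sub_distrib]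
    rw [modWalkCount_eq_sum_coeff n hℓ, ← Finset.mul_sum, sum_coeff_one_sub_X_mul,
      Polynomial.coeff_one_add_X_pow]
  rw [heq] at hmain
  refine hmain.trans ?_
  have := mul_le_mul_of_nonneg_left (coeffNorm_one_sub_X_pow_three_mul_le hn)
    (show (0 : ℝ) ≤ 7 * ℓ ^ 2 * 1 by positivity)
  linarith

/-! ### The middle binomial coefficient -/

theorem wallis_mul_sq_centralBinom (k : ℕ) :
    Real.Wallis.W k * ((Nat.centralBinom k : ℝ) / 4 ^ k) ^ 2 * (2 * k + 1) = 1 := by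
  have h : ((2 * k).factorial : ℝ) = Nat.centralBinom k * k.factorial ^ 2 := by
    rw [pow_two, ← mul_assoc]
    have := Nat.choose_mul_factorial_mul_factorial (show k ≤ 2 * k by omega)
    rw [show 2 * k - k = k by omega, ← Nat.centralBinom_eq_two_mul_choose] at this
    exact_mod_cast this.symm
  have hc : (Nat.centralBinom k : ℝ) ≠ 0 := by exact_mod_cast Nat.centralBinom_ne_zero k
  have hk : (k.factorial : ℝ) ≠ 0 := by exact_mod_cast k.factorial_ne_zero
  have h2 : (2 : ℝ) * k + 1 ≠ 0 := by positivity
  have h4 : (2 : ℝ) ^ (4 * k) = (4 ^ k) ^ 2 := by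
    rw [← pow_mul, mul_comm k 2, pow_mul, pow_mul]
    norm_num
  rw [Real.Wallis.W_eq_factorial_ratio, h, h4]
  field_simp

/-- For odd `n` the middle coefficient is half of the next central one, so both parities reduce to
central binomials. -/
theorem choose_half_eq (n : ℕ) :
    (n.choose (n / 2) : ℝ) / 2 ^ n = Nat.centralBinom ((n + 1) / 2) / 4 ^ ((n + 1) / 2) := by
  rcases Nat.even_or_odd' n with ⟨k, rfl | rfl⟩
  · rw [show (2 * k + 1) / 2 = k by omega, show 2 * k / 2 = k by omega,
      Nat.centralBinom_eq_two_mul_choose, pow_mul]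
    norm_num
  · rw [show (2 * k + 1 + 1) / 2 = k + 1 by omega, show (2 * k + 1) / 2 = k by omega,
      Nat.centralBinom_eq_two_mul_choose, show 2 * (k + 1) = 2 * k + 1 + 1 by ring,
      Nat.choose_succ_succ, ← Nat.choose_symm_half k]
    have h4 : (4 : ℝ) ^ (k + 1) = 2 * 2 ^ (2 * k + 1) := by
      rw [← pow_succ', show 2 * k + 1 + 1 = 2 * (k + 1) by ring, pow_mul]
      norm_num
    rw [h4]
    push_cast
    field_simp
    ring

/-- Stirling's approximation of the middle binomial coefficient with its error term. -/
theorem abs_sqrt_mul_choose_half_sub_le {n : ℕ} (hn : 1 ≤ n) :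
    |√n * ((n.choose (n / 2) : ℝ) / 2 ^ n) - √(2 / Real.pi)| ≤ 2 / n := by
  rw [choose_half_eq]
  set k := (n + 1) / 2 with hk
  set c : ℝ := (Nat.centralBinom k : ℝ) / 4 ^ k with hc
  set W := Real.Wallis.W k with hW
  set s := √(2 / Real.pi) with hs
  have hπ := Real.pi_pos
  have hn0 : (0 : ℝ) < n := by exact_mod_cast hn
  have hW0 : 0 < W := Real.Wallis.W_pos k
  have hkey : W * c ^ 2 * (2 * k + 1) = 1 := wallis_mul_sq_centralBinom k
  have hs0 : 0 < s := Real.sqrt_pos.2 (by positivity)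
  have hs2 : s ^ 2 * Real.pi = 2 := by
    rw [hs, Real.sq_sqrt (by positivity)]
    field_simp
  have hs1 : s ≤ 1 := by
    rw [hs, Real.sqrt_le_iff, one_pow, div_le_one hπ]
    exact ⟨zero_le_one, by linarith [Real.pi_gt_three]⟩
  have hc0 : 0 ≤ c := by positivity
  have hnk1 : (n : ℝ) ≤ 2 * k := by
    have : n ≤ 2 * k := by omega
    exact_mod_cast this
  have hnk2 : (2 : ℝ) * k ≤ n + 1 := by
    have : 2 * k ≤ n + 1 := by omega
    exact_mod_cast this
  have ht2 : (√n * c) ^ 2 = n * c ^ 2 := by rw [mul_pow, Real.sq_sqrt hn0.le]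
  have ht0 : 0 ≤ √n * c := by positivity
  have hc2 : 0 ≤ c ^ 2 := sq_nonneg c
  -- Wallis' bounds `(2k + 1) / (2k + 2) · π/2 ≤ W ≤ π/2` bound `c ^ 2 = 1 / (W (2k + 1))` on both
  -- sides.
  have hupper : (√n * c) ^ 2 ≤ s ^ 2 := by
    rw [ht2]
    have h1 := Real.Wallis.le_W k
    rw [← hW, div_mul_eq_mul_div, div_le_iff₀ (by positivity)] at h1
    have h2 : (2 * (k : ℝ) + 1) ^ 2 * (c ^ 2 * Real.pi) ≤ 2 * (2 * k + 2) := by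
      have := mul_le_mul_of_nonneg_right h1 (mul_nonneg hc2 (by positivity : (0 : ℝ) ≤ 2 * k + 1))
      nlinarith
    have h3 : (n : ℝ) * (c ^ 2 * Real.pi) * (2 * k + 2) ≤
        (2 * (k : ℝ) + 1) ^ 2 * (c ^ 2 * Real.pi) := by
      have : (n : ℝ) * (2 * k + 2) ≤ (2 * (k : ℝ) + 1) ^ 2 := by nlinarith
      have := mul_le_mul_of_nonneg_right this (mul_nonneg hc2 hπ.le)
      linarith
    have h4 : (n : ℝ) * (c ^ 2 * Real.pi) ≤ 2 :=
      le_of_mul_le_mul_right (h3.trans h2) (by positivity)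
    refine le_of_mul_le_mul_right ?_ hπ
    linarith
  have hlower : s ^ 2 * n ≤ (√n * c) ^ 2 * (n + 2) := by
    rw [ht2]
    have h1 : W ≤ Real.pi / 2 := Real.Wallis.W_le k
    have h2 : 1 ≤ Real.pi / 2 * (c ^ 2 * (n + 2)) := by
      rw [← hkey, mul_assoc]
      exact mul_le_mul h1 (mul_le_mul_of_nonneg_left (by linarith) hc2) (by positivity)
        (by positivity)
    have h3 := mul_le_mul_of_nonneg_left h2 (mul_nonneg (sq_nonneg s) hn0.le)
    have h4 : s ^ 2 * n * (Real.pi / 2 * (c ^ 2 * (n + 2))) =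
        s ^ 2 * Real.pi / 2 * (n * c ^ 2 * (n + 2)) := by ring
    rw [h4, hs2] at h3
    linarith
  have hts : √n * c ≤ s := le_of_sq_le_sq hupper hs0.le
  rw [abs_sub_comm, abs_of_nonneg (by linarith), le_div_iff₀ hn0]
  -- The bounds hold for the squares; factoring `s ^ 2 - (√n * c) ^ 2` avoids losing a square root
  -- in the error.
  have h5 : (s - √n * c) * n * (s + √n * c) ≤ 2 * s * (s + √n * c) := by nlinarith
  have h6 := le_of_mul_le_mul_right h5 (by linarith)
  linarith

/-! ### The asymptotic formula -/

open scoped Asymptotics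

theorem rpow_neg_half_mul_two_pow (n : ℕ) :
    (n : ℝ) ^ (-(1 / 2) : ℝ) * 2 ^ n = 2 ^ n / √n := by
  rw [Real.rpow_neg (Nat.cast_nonneg n), ← Real.sqrt_eq_rpow]
  ring

theorem modWalkAsymp_eq (ℓ n : ℕ) :
    modWalkAsymp ℓ n = modWalkDensity ℓ n * (√(2 / Real.pi) * (2 ^ n / √n)) := by
  rw [← rpow_neg_half_mul_two_pow, ← mul_assoc √(2 / Real.pi), modWalkAsymp, modWalkDensity,
    halfLineAsymp]
  split_ifs <;> rfl

theorem abs_modWalkCount_sub_asymp_le {ℓ n : ℕ} (hℓ : 2 ≤ ℓ) (hn : 1 ≤ n) :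
    |(modWalkCount ℓ n : ℝ) - modWalkAsymp ℓ n| ≤
      (504 * ℓ ^ 2 + 2) * (1 / n) * (2 ^ n / √n) := by
  have hn0 : (0 : ℝ) < n := by exact_mod_cast hn
  have hsq : 0 < √(n : ℝ) := Real.sqrt_pos.2 hn0
  obtain ⟨hd1, hd2⟩ := modWalkDensity_mem n hℓ
  set δ := modWalkDensity ℓ n with hδ
  have h1 := abs_modWalkCount_sub_density_mul_choose_le hℓ hn
  have h2 := abs_sqrt_mul_choose_half_sub_le hn
  have hsplit : (modWalkCount ℓ n : ℝ) - modWalkAsymp ℓ n =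
      ((modWalkCount ℓ n : ℝ) - δ * n.choose (n / 2)) +
        δ * ((√n * ((n.choose (n / 2) : ℝ) / 2 ^ n) - √(2 / Real.pi)) * (2 ^ n / √n)) := by
    rw [modWalkAsymp_eq, ← hδ]
    field_simp
    ring
  have h3 : |δ * ((√n * ((n.choose (n / 2) : ℝ) / 2 ^ n) - √(2 / Real.pi)) * (2 ^ n / √n))| ≤
      1 * (2 / n * (2 ^ n / √n)) := by
    rw [abs_mul, abs_mul, abs_of_nonneg (show 0 ≤ δ by linarith),
      abs_of_nonneg (show (0 : ℝ) ≤ 2 ^ n / √n by positivity)]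
    gcongr
  rw [hsplit]
  refine (abs_add_le _ _).trans ((add_le_add h1 h3).trans (le_of_eq ?_))
  field_simp

theorem theorem2p8 (ℓ : ℕ) (hℓ : 2 ≤ ℓ) :
    Asymptotics.IsEquivalent Filter.atTop
        (fun n : ℕ => (modWalkCount ℓ n : ℝ)) (fun n : ℕ => modWalkAsymp ℓ n) ∧
      Asymptotics.IsBigO Filter.atTop
        (fun n : ℕ => |(modWalkCount ℓ n : ℝ) - modWalkAsymp ℓ n| /
          ((n : ℝ) ^ (-(1 / 2) : ℝ) * 2 ^ n))
        (fun n : ℕ => 1 / (n : ℝ)) := by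
  have hpos : ∀ n : ℕ, 1 ≤ n → (0 : ℝ) < 2 ^ n / √n := fun n hn => by
    have : (0 : ℝ) < n := by exact_mod_cast hn
    positivity
  have hdiff : (fun n : ℕ => (modWalkCount ℓ n : ℝ) - modWalkAsymp ℓ n) =O[Filter.atTop]
      fun n : ℕ => 1 / (n : ℝ) * (2 ^ n / √n) := by
    refine Asymptotics.IsBigO.of_bound (504 * ℓ ^ 2 + 2) ?_
    filter_upwards [Filter.eventually_ge_atTop 1] with n hn
    have hn0 : (0 : ℝ) < n := by exact_mod_cast hn
    rw [Real.norm_eq_abs, Real.norm_of_nonneg (mul_pos (by positivity) (hpos n hn)).le, ← mul_assoc]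
    exact abs_modWalkCount_sub_asymp_le hℓ hn
  have hlittle : (fun n : ℕ => 1 / (n : ℝ) * (2 ^ n / √n)) =o[Filter.atTop]
      fun n : ℕ => (2 : ℝ) ^ n / √n := by
    have h1 : (fun n : ℕ => 1 / (n : ℝ)) =o[Filter.atTop] fun _ => (1 : ℝ) :=
      (Asymptotics.isLittleO_one_iff ℝ).2 tendsto_one_div_atTop_nhds_zero_nat
    simpa using h1.mul_isBigO (Asymptotics.isBigO_refl (fun n : ℕ => (2 : ℝ) ^ n / √n) _)
  have hs : 0 < √(2 / Real.pi) := Real.sqrt_pos.2 (by positivity)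
  have hmain : (fun n : ℕ => (2 : ℝ) ^ n / √n) =O[Filter.atTop] fun n => modWalkAsymp ℓ n := by
    refine Asymptotics.IsBigO.of_bound (2 / √(2 / Real.pi)) ?_
    filter_upwards [Filter.eventually_ge_atTop 1] with n hn
    have hd := (modWalkDensity_mem n hℓ).1
    have hD := hpos n hn
    have hA : 0 ≤ modWalkDensity ℓ n * (√(2 / Real.pi) * (2 ^ n / √n)) :=
      mul_nonneg (by linarith) (mul_pos hs hD).le
    rw [modWalkAsymp_eq, Real.norm_of_nonneg hD.le, Real.norm_of_nonneg hA]
    have heq : 2 / √(2 / Real.pi) * (modWalkDensity ℓ n * (√(2 / Real.pi) * (2 ^ n / √n))) =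
        2 * modWalkDensity ℓ n * (2 ^ n / √n) := by
      rw [mul_left_comm, ← mul_assoc (2 / _), div_mul_cancel₀ _ hs.ne']
      ring
    rw [heq]
    nlinarith
  refine ⟨(hdiff.trans_isLittleO hlittle).trans_isBigO hmain, ?_⟩
  refine Asymptotics.IsBigO.of_bound (504 * ℓ ^ 2 + 2) ?_
  filter_upwards [Filter.eventually_ge_atTop 1] with n hn
  have hD := hpos n hn
  rw [rpow_neg_half_mul_two_pow, Real.norm_of_nonneg (div_nonneg (abs_nonneg _) hD.le),
    Real.norm_of_nonneg (by positivity), div_le_iff₀ hD]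
  exact abs_modWalkCount_sub_asymp_le hℓ hn
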